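/- Let $G=(V,E)$ be a finite simple undirected graph that is connected, has minimal degree at least two, and has maximal degree greater than two. Let $\vec{E}$ be the set of its directed edges (each edge gives two). For $e=(u,v)\in\vec{E}$ put $\mathrm{outdeg}(e)=\deg(v)-1$, and write $e\to f$ if the head of $e$ is the tail of $f$ and $f$ is not the reversal of $e$. For $\ell\ge 0$ let $\Omega_\ell$ be the set of sequences $\omega=(e_0,e_1,\ldots,e_\ell)$ of directed edges with $e_i\to e_{i+1}$ for all $0\le i<\ell$, with the probability measure $$\mu[\omega]=\frac{1}{|\vec{E}|}\prod_{i=0}^{\ell-1}\frac{1}{\mathrm{outdeg}(e_i)},$$ which is the law of the length-$\ell$ non-backtracking random walk started from its stationary (uniform) distribution. Let $R_\ell(\omega)=\sum_{i=0}^{\ell-1}\log_2\mathrm{outdeg}(e_i)$ be the number of random bits used by the walk. Let $$\Lambda=\Bigl(\prod_{e\in\vec{E}}\mathrm{outdeg}(e)\Bigr)^{1/|\vec{E}|}$$ and let $\rho=\lim_{r\to\infty}|B_r|^{1/r}$ be the growth rate of the universal cover of $G$: this is the tree whose vertices are the finite non-backtracking walks in $G$ from a fixed vertex $v_0$, two of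 them being adjacent if one extends the other by a single step, and $B_r$ is its ball of radius $r$ around the empty walk ($\rho$ does not depend on $v_0$). Then, as $\ell\to\infty$ with $G$ fixed, $$\mathrm{Var}[R_\ell]=\begin{cases}O(1) & \text{if } \rho=\Lambda,\\ \Theta(\ell) & \text{if } \rho>\Lambda.\end{cases}$$ -/

import Mathlib

open Filter Asymptotics MeasureTheory ProbabilityTheory

noncomputable section

namespace NBRW

variable {V : Type*}

/-- From the directed edge `e` one can transition to the directed edge `f`: the head of `e` is the
tail of `f`, and `f` is not the reversal of `e`. -/
def Step {G : SimpleGraph V} (e f : G.Dart) : Prop :=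
  e.snd = f.fst ∧ e.symm ≠ f

/-! ### The universal covering tree and its growth rate -/

/-- The finite non-backtracking walks in `G` starting at the vertex `v₀`, as lists of consecutive
directed edges; the empty list is the empty walk. -/
def WalkFrom (G : SimpleGraph V) (v₀ : V) : Type _ :=
  {p : List G.Dart // p.IsChain Step ∧ ∀ e ∈ p.head?, e.fst = v₀}

/-- The empty walk. -/
def WalkFrom.empty (G : SimpleGraph V) (v₀ : V) : WalkFrom G v₀ :=
  ⟨[], by simp⟩

/-- The walk `q` extends the walk `p` by a single step. -/
def WalkFrom.Extends {G : SimpleGraph V} {v₀ : V} (p q : WalkFrom G v₀) : Prop :=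
  ∃ e : G.Dart, q.1 = p.1 ++ [e]

/-- The universal cover of `G`: its vertices are the finite non-backtracking walks from `v₀`, and
two of them are adjacent if one extends the other by a single step. -/
def universalCover (G : SimpleGraph V) (v₀ : V) : SimpleGraph (WalkFrom G v₀) where
  Adj p q := p.Extends q ∨ q.Extends p
  symm := ⟨fun _ _ h => h.symm⟩
  loopless := ⟨fun p h => by
    rcases h with ⟨e, he⟩ | ⟨e, he⟩ <;> simpa using congrArg List.length he⟩

/-- The (closed) ball of radius `r` around the vertex `x` of the graph `T`. -/
def closedBall {W : Type*} (T : SimpleGraph W) (x : W) (r : ℕ) : Set W :=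
  {y | T.edist x y ≤ r}

/-- `ρ(G)`, the growth rate of the universal cover: the limit of `|B_r| ^ (1 / r)`, where `B_r` is
the ball of radius `r` around the root. It is written as an upper limit so as to be defined before
the limit is known to exist. -/
def rho (G : SimpleGraph V) (v₀ : V) : ℝ :=
  limsup (fun r : ℕ =>
    ((closedBall (universalCover G v₀) (WalkFrom.empty G v₀) r).ncard : ℝ) ^ (1 / (r : ℝ))) atTop

/-! ### Degrees and the average growth rate -/

/-- `G` is connected, with minimal degree at least two and maximal degree more than two. -/
structure NBIrreducible [Fintype V] (G : SimpleGraph V) [DecidableRel G.Adj] : Prop where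
  connected : G.Connected
  two_le_degree : ∀ v, 2 ≤ G.degree v
  exists_two_lt_degree : ∃ v, 2 < G.degree v

/-- The degree of the head of `e`, minus one. (The subtraction never truncates: the head of a
directed edge has degree at least one.) -/
def outdeg {G : SimpleGraph V} [Fintype V] [DecidableRel G.Adj] (e : G.Dart) : ℕ :=
  G.degree e.snd - 1

/-- `Λ(G)`, the geometric mean of `outdeg e` over all directed edges `e`. -/
def Lam (G : SimpleGraph V) [Fintype V] [DecidableRel G.Adj] : ℝ :=
  (∏ e : G.Dart, (outdeg e : ℝ)) ^ (1 / (Fintype.card G.Dart : ℝ))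

/-! ### The stationary non-backtracking random walk -/

/-- The set `Ω_ℓ` of non-backtracking walks `(e₀, e₁, …, e_ℓ)` of length `ℓ`. -/
def Walks (G : SimpleGraph V) (ℓ : ℕ) : Type _ :=
  {ω : Fin (ℓ + 1) → G.Dart // ∀ i : Fin ℓ, Step (ω i.castSucc) (ω i.succ)}

instance (G : SimpleGraph V) (ℓ : ℕ) : MeasurableSpace (Walks G ℓ) := ⊤

section

variable (G : SimpleGraph V) [Fintype V] [DecidableRel G.Adj]

/-- The probability of the walk `(e₀, …, e_ℓ)`: the initial directed edge is uniform (the stationary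
distribution), and from `e` each of the `outdeg e` possible transitions is equally likely. -/
def walkProb {ℓ : ℕ} (ω : Walks G ℓ) : ℝ :=
  1 / (Fintype.card G.Dart : ℝ) * ∏ i : Fin ℓ, 1 / (outdeg (ω.1 i.castSucc) : ℝ)

/-- The law `μ` on `Ω_ℓ` of the length `ℓ` walk started from the stationary distribution. -/
def walkMeasure (ℓ : ℕ) : Measure (Walks G ℓ) :=
  Measure.sum fun ω => ENNReal.ofReal (walkProb G ω) • Measure.dirac ω

/-- `R_ℓ`, the number of random bits used by the walk. -/
def bits (ℓ : ℕ) (ω : Walks G ℓ) : ℝ :=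
  ∑ i : Fin ℓ, Real.logb 2 (outdeg (ω.1 i.castSucc))

end

end NBRW

end

/-!
Let `P` be the transition matrix of the non-backtracking walk on the directed edges. The
predecessors of a directed edge all have the same `outdeg`, which is also their number, so `P` is
doubly stochastic. The hypotheses on `G` make it irreducible: a function invariant under steps is
constant on the directed edges at a vertex of degree at least three, hence everywhere by
connectivity.

The Poisson equation `h - P h = log₂ ∘ outdeg - log₂ Λ` therefore has a solution `h`, and up to the
bounded term `h e₀ - h e_ℓ` the centred number of bits is a martingale with increments
`d e f = h f - P h e`. By orthogonality of the increments and stationarity the martingale has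
variance `ℓ σ²`, where `σ²` is the stationary mean of `d²` (`NBIrreducible.walkExp_martingale_sq`),
and a bounded perturbation does not affect whether the variance is bounded or of order `ℓ`
(`NBIrreducible.exists_variance_bits_bounds`). What remains is that `σ² = 0` precisely when `ρ = Λ`.

If `σ² = 0`, then `outdeg e = Λ * 2 ^ h e / 2 ^ h f` along steps `e → f`, so `2 ^ h` is a positive
eigenvector of the non-backtracking matrix with eigenvalue `Λ`. The eigenvalue of any positive
eigenvector is the growth rate of the number of non-backtracking walks, so `ρ = Λ`
(`NBIrreducible.rho_eq`).

Conversely, the Perron–Frobenius theorem, proved here by the Collatz–Wielandt argument, gives a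
positive eigenvector `u`, whose eigenvalue is `ρ`. Averaging the concavity inequality for the
logarithm of `u` over the stationary walk gives `Λ ≤ ρ`, and in the case of equality `u` is constant
on the successors of each directed edge (`NBIrreducible.outdeg_mul_eq`). Then `log₂ ∘ outdeg` is
`log₂ ρ` plus a coboundary, the number of bits telescopes, and its variance is bounded.
-/

open Filter Asymptotics MeasureTheory ProbabilityTheory

namespace NBRW

/-! ### Positive eigenvectors of irreducible nonnegative matrices -/

open Matrix Finset in
theorem le_one_add_pow_mulVec {D : Type*} [Fintype D] [DecidableEq D] {A : Matrix D D ℝ}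
    (hA : ∀ e f, 0 ≤ A e f) {x : D → ℝ} (hx : ∀ e, 0 ≤ x e) (n : ℕ) (e : D) :
    x e ≤ (((1 + A) ^ n) *ᵥ x) e := by
  induction n generalizing e with
  | zero => simp
  | succ n ih =>
    rw [pow_succ', ← mulVec_mulVec, add_mulVec, one_mulVec, Pi.add_apply]
    have : 0 ≤ (A *ᵥ ((1 + A) ^ n *ᵥ x)) e :=
      sum_nonneg fun f _ => mul_nonneg (hA e f) ((hx f).trans (ih f))
    linarith [ih e]

open Matrix Finset in
/-- For an irreducible nonnegative matrix `A`, a high power of `1 + A` maps each nonzero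
nonnegative vector to a strictly positive one. -/
theorem exists_one_add_pow_mulVec_pos {D : Type*} [Fintype D] [DecidableEq D] {A : Matrix D D ℝ}
    (hA : ∀ e f, 0 ≤ A e f) (hirr : ∀ e f, Relation.ReflTransGen (fun a b => 0 < A a b) e f)
    {x : D → ℝ} (hx : ∀ e, 0 ≤ x e) (hx0 : ∃ f, 0 < x f) :
    ∃ N : ℕ, ∀ n ≥ N, ∀ e, 0 < (((1 + A) ^ n) *ᵥ x) e := by
  obtain ⟨f, hf⟩ := hx0
  have key : ∀ e, ∃ N : ℕ, ∀ n ≥ N, 0 < (((1 + A) ^ n) *ᵥ x) e := by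
    intro e
    induction hirr e f using Relation.ReflTransGen.head_induction_on with
    | refl => exact ⟨0, fun n _ => hf.trans_le (le_one_add_pow_mulVec hA hx n f)⟩
    | @head a c hac _ ih =>
      obtain ⟨N, hN⟩ := ih
      refine ⟨N + 1, fun n hn => ?_⟩
      obtain ⟨n, rfl⟩ : ∃ m, n = m + 1 := ⟨n - 1, by omega⟩
      have hnn : ∀ f, 0 ≤ (((1 + A) ^ n) *ᵥ x) f := fun f =>
        (hx f).trans (le_one_add_pow_mulVec hA hx n f)
      rw [pow_succ', ← mulVec_mulVec, add_mulVec, one_mulVec, Pi.add_apply]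
      have h1 : A a c * (((1 + A) ^ n) *ᵥ x) c ≤ (A *ᵥ ((1 + A) ^ n *ᵥ x)) a :=
        single_le_sum (f := fun f => A a f * (((1 + A) ^ n) *ᵥ x) f)
          (fun f _ => mul_nonneg (hA a f) (hnn f)) (mem_univ c)
      have h2 := mul_pos hac (hN n (by omega))
      linarith [hnn a]
  choose N hN using key
  exact ⟨univ.sup N, fun n hn e => hN e n ((le_sup (mem_univ e)).trans hn)⟩

open Matrix Finset in
/-- The existence part of the Perron–Frobenius theorem. The eigenvalue is the Collatz–Wielandt
value: the largest `t` such that `t • x ≤ A *ᵥ x` for some probability vector `x`. -/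
theorem exists_pos_eigenvector {D : Type*} [Fintype D] [Nonempty D] {A : Matrix D D ℝ}
    (hA : ∀ e f, 0 ≤ A e f) (hirr : ∀ e f, Relation.ReflTransGen (fun a b => 0 < A a b) e f) :
    ∃ (t : ℝ) (x : D → ℝ), (∀ e, 0 < x e) ∧ ∀ e, ∑ f, A e f * x f = t * x e := by
  classical
  set M : ℝ := ∑ e, ∑ f, A e f with hM
  have hM0 : 0 ≤ M := sum_nonneg fun e _ => sum_nonneg fun f _ => hA e f
  let K : Set ((D → ℝ) × ℝ) :=
    (stdSimplex ℝ D ×ˢ Set.Icc 0 M) ∩ {p | ∀ e, p.2 * p.1 e ≤ (A *ᵥ p.1) e}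
  have hKc : IsCompact K := by
    refine ((isCompact_stdSimplex ℝ D).prod isCompact_Icc).inter_right ?_
    simp only [Set.ofPred_forall]
    refine isClosed_iInter fun e => isClosed_le (by fun_prop) ?_
    simp only [mulVec, dotProduct]
    fun_prop
  obtain ⟨e₀⟩ := ‹Nonempty D›
  have hKn : K.Nonempty := by
    refine ⟨(Pi.single e₀ 1, 0), ⟨⟨single_mem_stdSimplex ℝ e₀, le_rfl, hM0⟩, fun e => ?_⟩⟩
    simpa using hA e e₀
  obtain ⟨⟨x, t⟩, ⟨⟨hx, ht⟩, hxt⟩, hmax⟩ := hKc.exists_isMaxOn hKn continuous_snd.continuousOn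
  -- The bound `t ≤ M` in `K` is automatic.
  have hbound : ∀ y s, y ∈ stdSimplex ℝ D → 0 ≤ s → (∀ e, s * y e ≤ (A *ᵥ y) e) → s ≤ t := by
    intro y s hy hs hys
    refine hmax (a := (y, s)) ⟨⟨hy, hs, ?_⟩, hys⟩
    calc s = ∑ e, s * y e := by rw [← mul_sum, hy.2, mul_one]
      _ ≤ ∑ e, (A *ᵥ y) e := sum_le_sum fun e _ => hys e
      _ ≤ M := sum_le_sum fun e _ => sum_le_sum fun f _ =>
        mul_le_of_le_one_right (hA e f) ((single_le_sum (fun i _ => hy.1 i) (mem_univ f)).trans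
          hy.2.le)
  have hxpos : ∃ f, 0 < x f := by
    by_contra! h
    have := sum_nonpos (s := univ) fun f _ => h f
    rw [hx.2] at this
    linarith
  obtain ⟨N, hN⟩ := exists_one_add_pow_mulVec_pos hA hirr hx.1 hxpos
  have heig : A *ᵥ x = t • x := by
    by_contra hne
    set z : D → ℝ := A *ᵥ x - t • x with hz
    have hz0 : ∀ e, 0 ≤ z e := fun e => by simpa [hz] using hxt e
    have hzpos : ∃ f, 0 < z f := by
      by_contra! h
      exact hne (sub_eq_zero.1 (funext fun e => le_antisymm (h e) (hz0 e)))
    obtain ⟨N', hN'⟩ := exists_one_add_pow_mulVec_pos hA hirr hz0 hzpos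
    set n := max N N'
    set T := (1 + A) ^ n
    set y := T *ᵥ x with hy
    have hypos : ∀ e, 0 < y e := hN n (le_max_left _ _)
    have hTz : ∀ e, 0 < (T *ᵥ z) e := hN' n (le_max_right _ _)
    have hcomm : A * T = T * A :=
      (((Commute.one_left A).add_left (Commute.refl A)).pow_left n).eq.symm
    have hAy : A *ᵥ y = t • y + T *ᵥ z := by
      rw [hz, mulVec_sub, mulVec_mulVec, hcomm, ← mulVec_mulVec, mulVec_smul]
      simp [hy]
    obtain ⟨e₁, -, he₁⟩ := exists_min_image univ (fun e => (T *ᵥ z) e / y e) ⟨e₀, mem_univ _⟩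
    set ε := (T *ᵥ z) e₁ / y e₁
    have hε : 0 < ε := div_pos (hTz e₁) (hypos e₁)
    have hS : 0 < ∑ e, y e := sum_pos (fun e _ => hypos e) ⟨e₀, mem_univ _⟩
    have := hbound ((∑ e, y e)⁻¹ • y) (t + ε) ⟨fun e => ?_, ?_⟩ (by linarith [ht.1]) fun e => ?_
    · linarith
    · exact mul_nonneg (inv_nonneg.2 hS.le) (hypos e).le
    · simp only [Pi.smul_apply, smul_eq_mul, ← mul_sum]
      exact inv_mul_cancel₀ hS.ne'
    · rw [mulVec_smul, hAy]
      simp only [Pi.smul_apply, smul_eq_mul, Pi.add_apply]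
      have h1 : ε * y e ≤ (T *ᵥ z) e := (le_div_iff₀ (hypos e)).1 (he₁ e (mem_univ e))
      have h2 := mul_le_mul_of_nonneg_left h1 (inv_nonneg.2 hS.le)
      linarith
  have hpow : ∀ n : ℕ, (1 + A) ^ n *ᵥ x = (1 + t) ^ n • x := by
    intro n
    induction n with
    | zero => simp
    | succ n ih =>
      rw [pow_succ', ← mulVec_mulVec, ih, mulVec_smul, add_mulVec, heig, one_mulVec, pow_succ]
      ext e
      simp only [Pi.smul_apply, smul_eq_mul, Pi.add_apply]
      ring
  refine ⟨t, x, fun e => ?_, fun e => congrFun heig e⟩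
  have := hN N le_rfl e
  rw [hpow] at this
  exact pos_of_mul_pos_right this (pow_nonneg (by linarith [ht.1]) N)

/-! ### The non-backtracking walk: irreducibility and the Poisson equation -/

section

variable {V : Type*} {G : SimpleGraph V}

theorem Step.symm_symm {e f : G.Dart} (h : Step e f) : Step f.symm e.symm := by
  refine ⟨?_, fun h' => h.2 ?_⟩
  · simpa using h.1.symm
  · simpa using h'.symm

theorem step_symm_symm_iff {e f : G.Dart} : Step f.symm e.symm ↔ Step e f :=
  ⟨fun h => by simpa using h.symm_symm, Step.symm_symm⟩

/-- The steps `x → v → y` at a vertex `v`. -/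
theorem step_mk {x v y : V} (hx : G.Adj x v) (hy : G.Adj v y) (hxy : x ≠ y) :
    Step (⟨(x, v), hx⟩ : G.Dart) ⟨(v, y), hy⟩ :=
  ⟨rfl, fun h => hxy (by simpa using congrArg (fun d : G.Dart => d.snd) h)⟩

section
variable [Fintype V] [DecidableRel G.Adj]

/-- At a vertex of degree at least three the steps connect all incident directed edges; connectivity
of `G` then spreads this to all directed edges. -/
theorem NBIrreducible.eq_of_step_invariant (hG : NBIrreducible G) {α : Type*} {h : G.Dart → α}
    (hh : ∀ e f, Step e f → h e = h f) (e f : G.Dart) : h e = h f := by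
  classical
  obtain ⟨v, hv⟩ := hG.exists_two_lt_degree
  have hcard : 2 < (G.neighborFinset v).card := by simpa using hv
  obtain ⟨x₀, hx₀⟩ : (G.neighborFinset v).Nonempty := Finset.card_pos.1 (by omega)
  rw [SimpleGraph.mem_neighborFinset] at hx₀
  set a := h ⟨(v, x₀), hx₀⟩ with ha
  -- Two outgoing edges at `v` are reached from a common incoming edge, whose tail is a third
  -- neighbour.
  have hout : ∀ y (hy : G.Adj v y), h ⟨(v, y), hy⟩ = a := by
    intro y hy
    obtain ⟨w, hw, hw'⟩ : ∃ w ∈ G.neighborFinset v, w ∉ ({x₀, y} : Finset V) :=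
      Finset.exists_mem_notMem_of_card_lt_card (Finset.card_le_two.trans_lt hcard)
    rw [SimpleGraph.mem_neighborFinset] at hw
    simp only [Finset.mem_insert, Finset.mem_singleton, not_or] at hw'
    rw [← hh _ _ (step_mk hw.symm hy hw'.2), hh _ _ (step_mk hw.symm hx₀ hw'.1)]
  have hin : ∀ y (hy : G.Adj y v), h ⟨(y, v), hy⟩ = a := by
    intro y hy
    obtain ⟨w, hw, hw'⟩ : ∃ w ∈ G.neighborFinset v, w ≠ y :=
      Finset.exists_mem_ne (by omega) y
    rw [SimpleGraph.mem_neighborFinset] at hw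
    rw [hh _ _ (step_mk hy hw hw'.symm), hout]
  have hall : ∀ w, Relation.ReflTransGen G.Adj v w →
      ∀ y, (∀ hy : G.Adj w y, h ⟨(w, y), hy⟩ = a) ∧ ∀ hy : G.Adj y w, h ⟨(y, w), hy⟩ = a := by
    intro w hw
    induction hw with
    | refl => exact fun y => ⟨hout y, hin y⟩
    | @tail b c _ hbc ih =>
      refine fun y => ⟨fun hy => ?_, fun hy => ?_⟩
      · by_cases hyb : y = b
        · subst hyb
          exact (ih c).2 hy
        · rw [← hh _ _ (step_mk hbc hy (Ne.symm hyb)), (ih c).1]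
      · by_cases hyb : y = b
        · subst hyb
          exact (ih c).1 hy
        · rw [hh _ _ (step_mk hy hbc.symm hyb), (ih c).2]
  have key : ∀ d : G.Dart, h d = a := fun d =>
    (hall d.fst ((SimpleGraph.reachable_iff_reflTransGen _ _).1
      (hG.connected.preconnected v d.fst)) d.snd).1 d.adj
  rw [key e, key f]

open Classical in
theorem card_step_left (e : G.Dart) : (Finset.univ.filter fun f => Step e f).card = outdeg e := by
  have h : (Finset.univ.filter fun f => Step e f) =
      (Finset.univ.filter fun d : G.Dart => d.fst = e.snd).erase e.symm := by
    ext f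
    simp [Step, eq_comm, and_comm]
  rw [h, Finset.card_erase_of_mem (by simp), outdeg, ← G.dart_fst_fiber_card_eq_degree]

open Classical in
theorem card_step_right (f : G.Dart) :
    (Finset.univ.filter fun e => Step e f).card = G.degree f.fst - 1 := by
  refine Eq.trans ?_ (card_step_left f.symm)
  exact Finset.card_nbij' SimpleGraph.Dart.symm SimpleGraph.Dart.symm
    (fun e he => by simpa [step_symm_symm_iff] using he)
    (fun e he => by simpa [← step_symm_symm_iff (e := e.symm)] using he)
    (fun e _ => e.symm_symm) (fun e _ => e.symm_symm)

theorem NBIrreducible.outdeg_pos (hG : NBIrreducible G) (e : G.Dart) : 0 < outdeg e := by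
  have := hG.two_le_degree e.snd
  unfold outdeg
  omega

theorem NBIrreducible.exists_step (hG : NBIrreducible G) (e : G.Dart) : ∃ f, Step e f := by
  classical
  have := hG.outdeg_pos e
  rw [← card_step_left, Finset.card_pos] at this
  simpa [Finset.Nonempty] using this

theorem NBIrreducible.exists_fst (hG : NBIrreducible G) (v : V) : ∃ e : G.Dart, e.fst = v := by
  obtain ⟨w, hw⟩ := (G.degree_pos_iff_exists_adj v).1 (by linarith [hG.two_le_degree v])
  exact ⟨⟨(v, w), hw⟩, rfl⟩

theorem NBIrreducible.nonempty_dart (hG : NBIrreducible G) : Nonempty G.Dart :=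
  ⟨(hG.exists_fst hG.exists_two_lt_degree.choose).choose⟩

open Classical in
/-- The transition probabilities of the non-backtracking random walk. -/
noncomputable def stepProb (G : SimpleGraph V) [DecidableRel G.Adj] (e f : G.Dart) : ℝ :=
  if Step e f then 1 / (outdeg e : ℝ) else 0

theorem stepProb_nonneg (e f : G.Dart) : 0 ≤ stepProb G e f := by
  unfold stepProb
  positivity

theorem NBIrreducible.stepProb_pos (hG : NBIrreducible G) {e f : G.Dart} (h : Step e f) :
    0 < stepProb G e f := by
  have := hG.outdeg_pos e
  rw [stepProb, if_pos h]
  positivity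

open Classical in
theorem sum_stepProb_mul (e : G.Dart) (h : G.Dart → ℝ) :
    ∑ f, stepProb G e f * h f = (∑ f, if Step e f then h f else 0) / outdeg e := by
  rw [Finset.sum_div]
  refine Finset.sum_congr rfl fun f _ => ?_
  unfold stepProb
  split_ifs <;> ring

theorem NBIrreducible.sum_stepProb (hG : NBIrreducible G) (e : G.Dart) :
    ∑ f, stepProb G e f = 1 := by
  classical
  have := hG.outdeg_pos e
  have h := sum_stepProb_mul e fun _ => (1 : ℝ)
  simp only [mul_one, Finset.sum_boole, card_step_left] at h
  rw [h, div_self (by positivity)]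

/-- The uniform distribution is stationary: all predecessors of `f` have the same head, and so the
same `outdeg`, which is also their number. -/
theorem NBIrreducible.sum_stepProb_left (hG : NBIrreducible G) (f : G.Dart) :
    ∑ e, stepProb G e f = 1 := by
  classical
  have h2 := hG.two_le_degree f.fst
  have h : ∀ e, stepProb G e f =
      (if Step e f then 1 else 0) * (1 / ((G.degree f.fst - 1 : ℕ) : ℝ)) := by
    intro e
    unfold stepProb outdeg
    split_ifs with hs
    · rw [hs.1, one_mul]
    · simp
  simp_rw [h]
  rw [← Finset.sum_mul, Finset.sum_boole, card_step_right, mul_one_div, div_self]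
  have : 0 < G.degree f.fst - 1 := by omega
  positivity

theorem NBIrreducible.sum_sum_stepProb_mul (hG : NBIrreducible G) (h : G.Dart → ℝ) :
    ∑ e, ∑ f, stepProb G e f * h f = ∑ f, h f := by
  rw [Finset.sum_comm]
  simp_rw [← Finset.sum_mul, hG.sum_stepProb_left, one_mul]

/-- The non-backtracking walk on the directed edges is irreducible. A set of directed edges closed
under steps has as much mass flowing in as out, hence is closed under reversed steps as well. -/
theorem NBIrreducible.reflTransGen_step (hG : NBIrreducible G) (e f : G.Dart) :
    Relation.ReflTransGen Step e f := by
  classical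
  set S : Finset G.Dart := Finset.univ.filter fun d => Relation.ReflTransGen Step e d with hS
  have hmem : ∀ d, d ∈ S ↔ Relation.ReflTransGen Step e d := by simp [hS]
  have hout : ∀ a ∈ S, ∑ b ∈ S, stepProb G a b = 1 := by
    intro a ha
    rw [← hG.sum_stepProb a]
    refine Finset.sum_subset (Finset.subset_univ _) fun b _ hb => if_neg fun hab => hb ?_
    exact (hmem b).2 (((hmem a).1 ha).tail hab)
  have hflow : ∑ a ∈ Sᶜ, ∑ b ∈ S, stepProb G a b = 0 := by
    have h1 : ∑ a, ∑ b ∈ S, stepProb G a b = S.card := by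
      rw [Finset.sum_comm]
      simp [hG.sum_stepProb_left]
    rw [← Finset.sum_add_sum_compl S, Finset.sum_congr rfl hout] at h1
    simpa using h1
  have hin : ∀ a b, Step a b → b ∈ S → a ∈ S := by
    intro a b hab hb
    by_contra ha
    have h1 := (Finset.sum_eq_zero_iff_of_nonneg fun a _ =>
      Finset.sum_nonneg fun b _ => stepProb_nonneg a b).1 hflow a (Finset.mem_compl.2 ha)
    have h2 := (Finset.sum_eq_zero_iff_of_nonneg fun b _ => stepProb_nonneg a b).1 h1 b hb
    exact (hG.stepProb_pos hab).ne' h2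
  have hinv : ∀ a b, Step a b → (a ∈ S) = (b ∈ S) := fun a b hab =>
    propext ⟨fun ha => (hmem b).2 (((hmem a).1 ha).tail hab), hin a b hab⟩
  rw [← hmem, ← hG.eq_of_step_invariant hinv e f, hmem]

/-- The Dirichlet form of a function `h` with `P h = h` vanishes, so `h` is constant along steps. -/
theorem NBIrreducible.eq_of_harmonic (hG : NBIrreducible G) {h : G.Dart → ℝ}
    (hh : ∀ e, ∑ f, stepProb G e f * h f = h e) (e f : G.Dart) : h e = h f := by
  refine hG.eq_of_step_invariant (fun a b hab => ?_) e f
  have hD : ∑ a, ∑ b, stepProb G a b * (h a - h b) ^ 2 = 0 := by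
    have h1 : ∀ a, ∑ b, stepProb G a b * (h a - h b) ^ 2 =
        ∑ b, stepProb G a b * h b ^ 2 - h a ^ 2 := by
      intro a
      calc ∑ b, stepProb G a b * (h a - h b) ^ 2
          = ∑ b, (stepProb G a b * h b ^ 2 + h a ^ 2 * stepProb G a b
              - 2 * h a * (stepProb G a b * h b)) := Finset.sum_congr rfl fun b _ => by ring
        _ = _ := by
          rw [Finset.sum_sub_distrib, Finset.sum_add_distrib, ← Finset.mul_sum, ← Finset.mul_sum,
            hh, hG.sum_stepProb]
          ring
    simp_rw [h1]
    rw [Finset.sum_sub_distrib, hG.sum_sum_stepProb_mul fun b => h b ^ 2, sub_self]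
  have hnn : ∀ a b, 0 ≤ stepProb G a b * (h a - h b) ^ 2 := fun a b =>
    mul_nonneg (stepProb_nonneg a b) (sq_nonneg _)
  have h1 := (Finset.sum_eq_zero_iff_of_nonneg fun a _ => Finset.sum_nonneg fun b _ => hnn a b).1
    hD a (Finset.mem_univ a)
  have h2 := (Finset.sum_eq_zero_iff_of_nonneg fun b _ => hnn a b).1 h1 b (Finset.mem_univ b)
  have h3 := (mul_eq_zero.1 h2).resolve_left (hG.stepProb_pos hab).ne'
  exact sub_eq_zero.1 (pow_eq_zero_iff two_ne_zero |>.1 h3)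

/-- The Poisson equation `h - P h = g` is solvable for every `g` of mean zero: the kernel of `1 - P`
is the line of constants and its range lies in the hyperplane of mean zero functions, so that the
range fills that hyperplane. -/
theorem NBIrreducible.exists_poisson (hG : NBIrreducible G) {g : G.Dart → ℝ}
    (hg : ∑ e, g e = 0) : ∃ h : G.Dart → ℝ, ∀ e, h e - ∑ f, stepProb G e f * h f = g e := by
  classical
  obtain ⟨e₀⟩ := hG.nonempty_dart
  let T : (G.Dart → ℝ) →ₗ[ℝ] (G.Dart → ℝ) :=
    LinearMap.id - Matrix.mulVecLin (Matrix.of (stepProb G))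
  have hT : ∀ h e, T h e = h e - ∑ f, stepProb G e f * h f := fun h e => by
    simp [T, Matrix.mulVec, dotProduct]
  let s : (G.Dart → ℝ) →ₗ[ℝ] ℝ := ∑ e, LinearMap.proj e
  have hs : ∀ h, s h = ∑ e, h e := fun h => by simp [s]
  have hker : T.ker ≤ Submodule.span ℝ {fun _ => (1 : ℝ)} := by
    intro h hh
    have h0 : ∀ e, ∑ f, stepProb G e f * h f = h e := fun e => by
      have := congrFun (LinearMap.mem_ker.1 hh) e
      rw [hT, Pi.zero_apply, sub_eq_zero] at this
      exact this.symm
    rw [Submodule.mem_span_singleton]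
    exact ⟨h e₀, funext fun e => by simpa using hG.eq_of_harmonic h0 e₀ e⟩
  have hrange : T.range ≤ s.ker := by
    rintro _ ⟨h, rfl⟩
    rw [LinearMap.mem_ker, hs]
    simp_rw [hT]
    rw [Finset.sum_sub_distrib, hG.sum_sum_stepProb_mul, sub_self]
  have hsurj : s.range = ⊤ := by
    refine LinearMap.range_eq_top.2 fun c => ⟨Pi.single e₀ c, ?_⟩
    rw [hs, Finset.sum_pi_single']
    simp
  have hk : Module.finrank ℝ T.ker ≤ 1 :=
    (Submodule.finrank_mono hker).trans (finrank_span_singleton fun h => one_ne_zero (congrFun h e₀)).le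
  have h1 := T.finrank_range_add_finrank_ker
  have h2 := s.finrank_range_add_finrank_ker
  rw [hsurj, finrank_top, Module.finrank_self] at h2
  have heq : T.range = s.ker := Submodule.eq_of_le_of_finrank_le hrange (by omega)
  obtain ⟨h, hh⟩ : g ∈ T.range := by rw [heq, LinearMap.mem_ker, hs, hg]
  exact ⟨h, fun e => by rw [← hT, hh]⟩

end

end

/-! ### The growth rate of the universal cover as an eigenvalue -/

section

variable {V : Type*} {G : SimpleGraph V}

theorem WalkFrom.length_le_add_walk_length {v₀ : V} {p q : WalkFrom G v₀}
    (w : (universalCover G v₀).Walk p q) : q.1.length ≤ p.1.length + w.length := by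
  induction w with
  | nil => simp
  | @cons p q _ h _ ih =>
    have h1 : q.1.length ≤ p.1.length + 1 := by
      rcases h with ⟨e, he⟩ | ⟨e, he⟩
      · simp [he]
      · simp only [he, List.length_append, List.length_singleton]
        omega
    rw [SimpleGraph.Walk.length_cons]
    omega

theorem WalkFrom.edist_empty_le {v₀ : V} (p : WalkFrom G v₀) :
    (universalCover G v₀).edist (WalkFrom.empty G v₀) p ≤ p.1.length := by
  obtain ⟨l, hl⟩ := p
  induction l using List.reverseRecOn with
  | nil => exact (SimpleGraph.edist_self).le
  | append_singleton l e ih =>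
    have hl' : l.IsChain Step ∧ ∀ e ∈ l.head?, e.fst = v₀ :=
      ⟨hl.1.left_of_append, fun f hf => hl.2 f (by simp_all [List.head?_append])⟩
    have hadj : (universalCover G v₀).Adj ⟨l, hl'⟩ ⟨l ++ [e], hl⟩ := Or.inl ⟨e, rfl⟩
    calc _ ≤ (universalCover G v₀).edist (WalkFrom.empty G v₀) ⟨l, hl'⟩
          + (universalCover G v₀).edist ⟨l, hl'⟩ ⟨l ++ [e], hl⟩ := SimpleGraph.edist_triangle
      _ ≤ l.length + 1 := add_le_add (ih hl') (SimpleGraph.edist_eq_one_iff_adj.2 hadj).le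
      _ = _ := by simp

/-- In the universal cover, the distance from the root is the length of the walk. -/
theorem mem_closedBall_universalCover {v₀ : V} {r : ℕ} {p : WalkFrom G v₀} :
    p ∈ closedBall (universalCover G v₀) (WalkFrom.empty G v₀) r ↔ p.1.length ≤ r := by
  refine ⟨fun h => ?_, fun h => p.edist_empty_le.trans (by exact_mod_cast h)⟩
  have h' : (universalCover G v₀).edist (WalkFrom.empty G v₀) p ≤ r := h
  obtain ⟨w, hw⟩ := SimpleGraph.exists_walk_of_edist_ne_top
    (h'.trans_lt (ENat.natCast_lt_top r)).ne
  rw [← hw] at h'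
  have h1 : p.1.length ≤ 0 + w.length := WalkFrom.length_le_add_walk_length w
  rw [zero_add] at h1
  exact h1.trans (by exact_mod_cast h')

theorem ncard_closedBall_eq (G : SimpleGraph V) (v₀ : V) (r : ℕ) :
    (closedBall (universalCover G v₀) (WalkFrom.empty G v₀) r).ncard =
      {p : List G.Dart | (p.IsChain Step ∧ ∀ e ∈ p.head?, e.fst = v₀) ∧ p.length ≤ r}.ncard := by
  have hinj : Function.Injective fun p : WalkFrom G v₀ => p.1 := Subtype.val_injective
  rw [← Set.ncard_image_of_injective _ hinj]
  congr 1
  ext p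
  constructor
  · rintro ⟨q, hq, rfl⟩
    exact ⟨q.2, mem_closedBall_universalCover.1 hq⟩
  · rintro ⟨hp, hr⟩
    exact ⟨⟨p, hp⟩, mem_closedBall_universalCover.2 hr, rfl⟩

open Classical in
/-- The non-backtracking (Hashimoto) matrix of `G`: the 0-1 matrix of the relation `Step`. -/
noncomputable def hashimoto (G : SimpleGraph V) : Matrix G.Dart G.Dart ℝ :=
  Matrix.of fun e f => if Step e f then 1 else 0

theorem hashimoto_nonneg (e f : G.Dart) : 0 ≤ hashimoto G e f := by
  simp only [hashimoto, Matrix.of_apply]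
  positivity

section
variable [Fintype V] [DecidableRel G.Adj]

open Classical in
/-- The non-backtracking walks with `k` steps, and so `k + 1` directed edges, whose first directed
edge is `e`. -/
noncomputable def chainsFrom : ℕ → G.Dart → Finset (List G.Dart)
  | 0, e => {[e]}
  | k + 1, e => (Finset.univ.filter fun f => Step e f).biUnion fun f =>
      (chainsFrom k f).image (List.cons e)

theorem mem_chainsFrom {k : ℕ} {e : G.Dart} {p : List G.Dart} :
    p ∈ chainsFrom k e ↔ p.IsChain Step ∧ p.head? = some e ∧ p.length = k + 1 := by
  classical
  induction k generalizing e p with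
  | zero =>
    rw [chainsFrom, Finset.mem_singleton]
    constructor
    · rintro rfl
      simp
    · rintro ⟨-, h1, h2⟩
      obtain ⟨a, rfl⟩ := List.length_eq_one_iff.1 h2
      simpa using h1
  | succ k ih =>
    simp only [chainsFrom, Finset.mem_biUnion, Finset.mem_filter, Finset.mem_univ, true_and,
      Finset.mem_image, ih]
    constructor
    · rintro ⟨f, hf, q, ⟨h1, h2, h3⟩, rfl⟩
      exact ⟨List.isChain_cons.2 ⟨by simpa [h2] using hf, h1⟩, rfl, by simp [h3]⟩
    · rintro ⟨h1, h2, h3⟩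
      match p, h1, h2, h3 with
      | a :: b :: q, h1, h2, h3 =>
        obtain rfl : a = e := by simpa using h2
        rw [List.isChain_cons_cons] at h1
        exact ⟨b, h1.1, b :: q, ⟨h1.2, rfl, by simpa using h3⟩, rfl⟩
      | [a], _, _, h3 => simp at h3

open Classical in
theorem card_chainsFrom_succ (k : ℕ) (e : G.Dart) :
    (chainsFrom (k + 1) e).card = ∑ f with Step e f, (chainsFrom k f).card := by
  rw [chainsFrom, Finset.card_biUnion]
  · exact Finset.sum_congr rfl fun f _ => Finset.card_image_of_injective _ List.cons_injective
  · intro f _ f' _ hff'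
    refine Finset.disjoint_left.2 fun p hp hp' => hff' ?_
    obtain ⟨q, hq, rfl⟩ := Finset.mem_image.1 hp
    obtain ⟨q', hq', h⟩ := Finset.mem_image.1 hp'
    obtain rfl := List.cons_injective h
    exact Option.some_injective _
      ((mem_chainsFrom.1 hq).2.1.symm.trans (mem_chainsFrom.1 hq').2.1)

open Classical in
theorem sum_hashimoto_mul (e : G.Dart) (u : G.Dart → ℝ) :
    ∑ f, hashimoto G e f * u f = ∑ f with Step e f, u f := by
  simp [hashimoto, Finset.sum_filter]

theorem NBIrreducible.exists_pos_eigenvector (hG : NBIrreducible G) :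
    ∃ (t : ℝ) (u : G.Dart → ℝ), (∀ e, 0 < u e) ∧
      ∀ e, ∑ f, hashimoto G e f * u f = t * u e := by
  have := hG.nonempty_dart
  refine NBRW.exists_pos_eigenvector (A := hashimoto G) hashimoto_nonneg fun e f =>
    Relation.ReflTransGen.mono (r := Step) (fun a b hab => ?_) e f (hG.reflTransGen_step e f)
  simp [hashimoto, hab]

variable {t c C : ℝ} {u : G.Dart → ℝ}

theorem mul_card_chainsFrom_le (hc : ∀ e, c ≤ u e)
    (hu : ∀ e, ∑ f, hashimoto G e f * u f = t * u e) (k : ℕ) (e : G.Dart) :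
    c * (chainsFrom k e).card ≤ t ^ k * u e := by
  classical
  induction k generalizing e with
  | zero => simpa [chainsFrom] using hc e
  | succ k ih =>
    rw [card_chainsFrom_succ, Nat.cast_sum, Finset.mul_sum, pow_succ, mul_assoc, ← hu,
      sum_hashimoto_mul, Finset.mul_sum]
    exact Finset.sum_le_sum fun f _ => ih f

theorem le_mul_card_chainsFrom (hC : ∀ e, u e ≤ C)
    (hu : ∀ e, ∑ f, hashimoto G e f * u f = t * u e) (k : ℕ) (e : G.Dart) :
    t ^ k * u e ≤ C * (chainsFrom k e).card := by
  classical
  induction k generalizing e with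
  | zero => simpa [chainsFrom] using hC e
  | succ k ih =>
    rw [card_chainsFrom_succ, Nat.cast_sum, Finset.mul_sum, pow_succ, mul_assoc, ← hu,
      sum_hashimoto_mul, Finset.mul_sum]
    exact Finset.sum_le_sum fun f _ => ih f

/-- Evaluate the eigenvector equation where `u` is minimal. -/
theorem NBIrreducible.one_le_eigenvalue (hG : NBIrreducible G) (hpos : ∀ e, 0 < u e)
    (hu : ∀ e, ∑ f, hashimoto G e f * u f = t * u e) : 1 ≤ t := by
  classical
  obtain ⟨e₀⟩ := hG.nonempty_dart
  obtain ⟨e, -, he⟩ := Finset.exists_min_image Finset.univ u ⟨e₀, Finset.mem_univ _⟩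
  obtain ⟨f, hf⟩ := hG.exists_step e
  have h1 : u f ≤ t * u e := by
    rw [← hu, sum_hashimoto_mul]
    exact Finset.single_le_sum (f := u) (fun i _ => (hpos i).le) (by simpa using hf)
  exact le_of_mul_le_mul_right (by linarith [he f (Finset.mem_univ f)]) (hpos e)

theorem closedBall_lists_subset (v₀ : V) (r : ℕ) [DecidableEq (List G.Dart)] :
    {p : List G.Dart | (p.IsChain Step ∧ ∀ e ∈ p.head?, e.fst = v₀) ∧ p.length ≤ r} ⊆
      ↑(insert [] ((Finset.range r).biUnion fun k =>
        (Finset.univ : Finset G.Dart).biUnion fun e => chainsFrom k e)) := by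
  rintro p ⟨hp, hr⟩
  cases p with
  | nil => simp
  | cons a q =>
    simp only [Finset.coe_insert, Set.mem_insert_iff, Finset.mem_coe, Finset.mem_biUnion,
      Finset.mem_range, Finset.mem_univ, true_and]
    exact Or.inr ⟨q.length, by simpa using hr, a, mem_chainsFrom.2 ⟨hp.1, rfl, rfl⟩⟩

/-- The number of walks of each length grows like the powers of the eigenvalue `t`, so the ball of
radius `r` has between `a * t ^ r` and `b * r * t ^ r` vertices. -/
theorem NBIrreducible.exists_bounds_ncard_closedBall (hG : NBIrreducible G) (v₀ : V)
    (hpos : ∀ e, 0 < u e) (hu : ∀ e, ∑ f, hashimoto G e f * u f = t * u e) :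
    ∃ a b : ℝ, 0 < a ∧ 0 < b ∧ ∀ r : ℕ, 1 ≤ r →
      a * t ^ r ≤ (closedBall (universalCover G v₀) (WalkFrom.empty G v₀) r).ncard ∧
      ((closedBall (universalCover G v₀) (WalkFrom.empty G v₀) r).ncard : ℝ) ≤ b * r * t ^ r := by
  classical
  obtain ⟨e₀, he₀⟩ := hG.exists_fst v₀
  have ht := hG.one_le_eigenvalue hpos hu
  have ht0 : 0 < t := by linarith
  obtain ⟨m, -, hm⟩ := Finset.exists_min_image Finset.univ u ⟨e₀, Finset.mem_univ _⟩
  obtain ⟨M, -, hM⟩ := Finset.exists_max_image Finset.univ u ⟨e₀, Finset.mem_univ _⟩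
  have hlow := le_mul_card_chainsFrom (fun e => hM e (Finset.mem_univ e)) hu
  have hup := mul_card_chainsFrom_le (fun e => hm e (Finset.mem_univ e)) hu
  have hm0 := hpos m
  have hM0 := hpos M
  have hpe := hpos e₀
  refine ⟨u e₀ / u M / t, 1 + Fintype.card G.Dart * (u M / u m), by positivity, by positivity,
    fun r hr => ?_⟩
  rw [ncard_closedBall_eq]
  have hsub := closedBall_lists_subset (G := G) v₀ r
  constructor
  · obtain ⟨k, rfl⟩ : ∃ k, r = k + 1 := ⟨r - 1, by omega⟩
    have h1 : (chainsFrom k e₀).card ≤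
        {p : List G.Dart | (p.IsChain Step ∧ ∀ e ∈ p.head?, e.fst = v₀) ∧
          p.length ≤ k + 1}.ncard := by
      rw [← Set.ncard_coe_finset]
      refine Set.ncard_le_ncard (fun p hp => ?_) ((Finset.finite_toSet _).subset hsub)
      obtain ⟨h1, h2, h3⟩ := mem_chainsFrom.1 hp
      refine ⟨⟨h1, fun e he => ?_⟩, h3.le⟩
      rw [h2] at he
      obtain rfl := Option.some_injective _ he
      exact he₀
    calc u e₀ / u M / t * t ^ (k + 1) = t ^ k * u e₀ / u M := by
          rw [pow_succ]
          field_simp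
      _ ≤ (chainsFrom k e₀).card := by
          rw [div_le_iff₀ hM0, mul_comm _ (u M)]
          exact hlow k e₀
      _ ≤ _ := by exact_mod_cast h1
  · have hcard : ∀ k < r, ∀ e : G.Dart, ((chainsFrom k e).card : ℝ) ≤ t ^ r * (u M / u m) := by
      intro k hk e
      rw [← mul_div_assoc, le_div_iff₀ hm0, mul_comm _ (u m)]
      refine (hup k e).trans ?_
      exact mul_le_mul (pow_le_pow_right₀ ht hk.le) (hM e (Finset.mem_univ e)) (hpos e).le
        (by positivity)
    have h1 : ({p : List G.Dart | (p.IsChain Step ∧ ∀ e ∈ p.head?, e.fst = v₀) ∧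
        p.length ≤ r}.ncard) ≤ 1 + ∑ k ∈ Finset.range r, ∑ e, (chainsFrom (G := G) k e).card := by
      refine (Set.ncard_le_ncard hsub (Finset.finite_toSet _)).trans ?_
      rw [Set.ncard_coe_finset]
      refine (Finset.card_insert_le _ _).trans ?_
      rw [add_comm]
      refine Nat.add_le_add_left (Finset.card_biUnion_le.trans ?_) 1
      exact Finset.sum_le_sum fun k _ => Finset.card_biUnion_le
    have h2 : (1 : ℝ) ≤ r * t ^ r :=
      one_le_mul_of_one_le_of_one_le (by exact_mod_cast hr) (one_le_pow₀ ht)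
    calc _ ≤ (1 : ℝ) + ∑ k ∈ Finset.range r, ∑ e, ((chainsFrom (G := G) k e).card : ℝ) := by
          exact_mod_cast h1
      _ ≤ 1 + ∑ k ∈ Finset.range r, ∑ e : G.Dart, t ^ r * (u M / u m) := by
          gcongr with k hk e he
          exact hcard k (Finset.mem_range.1 hk) e
      _ = 1 + r * (Fintype.card G.Dart * (t ^ r * (u M / u m))) := by simp
      _ ≤ r * t ^ r + r * (Fintype.card G.Dart * (t ^ r * (u M / u m))) := by gcongr
      _ = _ := by ring

/-- The eigenvalue of any positive eigenvector of the non-backtracking matrix is the growth rate of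
the universal cover. -/
theorem NBIrreducible.rho_eq (hG : NBIrreducible G) (v₀ : V) (hpos : ∀ e, 0 < u e)
    (hu : ∀ e, ∑ f, hashimoto G e f * u f = t * u e) : rho G v₀ = t := by
  obtain ⟨a, b, ha, hb, hab⟩ := hG.exists_bounds_ncard_closedBall v₀ hpos hu
  have ht0 : 0 < t := zero_lt_one.trans_le (hG.one_le_eigenvalue hpos hu)
  have hinv : Tendsto (fun r : ℕ => 1 / (r : ℝ)) atTop (nhds 0) :=
    tendsto_one_div_atTop_nhds_zero_nat
  have hconst : ∀ x : ℝ, 0 < x → Tendsto (fun r : ℕ => x ^ (1 / (r : ℝ))) atTop (nhds 1) := by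
    intro x hx
    simpa using (tendsto_const_nhds (x := x)).rpow hinv (Or.inl hx.ne')
  have hr : Tendsto (fun r : ℕ => (r : ℝ) ^ (1 / (r : ℝ))) atTop (nhds 1) :=
    tendsto_rpow_div.comp tendsto_natCast_atTop_atTop
  have hroot : ∀ r : ℕ, 1 ≤ r → (t ^ r) ^ (1 / (r : ℝ)) = t := fun r hr => by
    rw [one_div, Real.pow_rpow_inv_natCast ht0.le (by omega)]
  refine Tendsto.limsup_eq (tendsto_of_tendsto_of_tendsto_of_le_of_le'
    (g := fun r : ℕ => a ^ (1 / (r : ℝ)) * t)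
    (h := fun r : ℕ => b ^ (1 / (r : ℝ)) * (r : ℝ) ^ (1 / (r : ℝ)) * t) ?_ ?_ ?_ ?_)
  · simpa using (hconst a ha).mul_const t
  · simpa using ((hconst b hb).mul hr).mul_const t
  · filter_upwards [eventually_ge_atTop 1] with r hr1
    have h := Real.rpow_le_rpow (by positivity) (hab r hr1).1 (z := 1 / (r : ℝ)) (by positivity)
    rwa [Real.mul_rpow ha.le (by positivity), hroot r hr1] at h
  · filter_upwards [eventually_ge_atTop 1] with r hr1
    have h := Real.rpow_le_rpow (by positivity) (hab r hr1).2 (z := 1 / (r : ℝ)) (by positivity)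
    rwa [Real.mul_rpow (by positivity) (by positivity), Real.mul_rpow hb.le (by positivity),
      hroot r hr1] at h

end

end

/-! ### The case of equality between the two growth rates -/

section

variable {V : Type*} {G : SimpleGraph V} [Fintype V] [DecidableRel G.Adj]

theorem NBIrreducible.Lam_pos (hG : NBIrreducible G) : 0 < Lam G :=
  Real.rpow_pos_of_pos (Finset.prod_pos fun e _ => Nat.cast_pos.2 (hG.outdeg_pos e)) _

theorem NBIrreducible.card_mul_log_Lam (hG : NBIrreducible G) :
    Fintype.card G.Dart * Real.log (Lam G) = ∑ e : G.Dart, Real.log (outdeg e) := by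
  have := hG.nonempty_dart
  have hpos : ∀ e : G.Dart, (0 : ℝ) < outdeg e := fun e => Nat.cast_pos.2 (hG.outdeg_pos e)
  have hc : (Fintype.card G.Dart : ℝ) ≠ 0 := by positivity
  rw [Lam, Real.log_rpow (Finset.prod_pos fun e _ => hpos e),
    Real.log_prod fun e _ => (hpos e).ne']
  field_simp

theorem sum_stepProb_mul_eq_hashimoto (e : G.Dart) (u : G.Dart → ℝ) :
    ∑ f, stepProb G e f * u f = (∑ f, hashimoto G e f * u f) / outdeg e := by
  classical
  rw [sum_stepProb_mul, sum_hashimoto_mul, Finset.sum_filter]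

/-- The equality case of `Λ ≤ ρ`. The bound is `Real.log_le_sub_one_of_pos` applied to each ratio
of `u f` to its mean `t * u e / outdeg e` over the steps `e → f`, averaged over all steps; equality
forces all the ratios to be one. -/
theorem NBIrreducible.outdeg_mul_eq (hG : NBIrreducible G) {t : ℝ} {u : G.Dart → ℝ}
    (hpos : ∀ e, 0 < u e) (hu : ∀ e, ∑ f, hashimoto G e f * u f = t * u e) (ht : t = Lam G)
    {e f : G.Dart} (hef : Step e f) : outdeg e * u f = t * u e := by
  have ht0 : 0 < t := ht ▸ hG.Lam_pos
  have hd : ∀ e : G.Dart, (0 : ℝ) < outdeg e := fun e => Nat.cast_pos.2 (hG.outdeg_pos e)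
  set A : G.Dart → ℝ := fun e => t * u e / outdeg e with hA
  have hA0 : ∀ e, 0 < A e := fun e => div_pos (mul_pos ht0 (hpos e)) (hd e)
  have hPu : ∀ e, ∑ f, stepProb G e f * u f = A e := fun e => by
    rw [sum_stepProb_mul_eq_hashimoto, hu]
  set φ : G.Dart → G.Dart → ℝ := fun e f =>
    stepProb G e f * (u f / A e - 1 - Real.log (u f / A e)) with hφ
  have hnn : ∀ e f, 0 ≤ φ e f := fun e f => mul_nonneg (stepProb_nonneg e f)
    (by linarith [Real.log_le_sub_one_of_pos (div_pos (hpos f) (hA0 e))])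
  have hrow : ∀ e, ∑ f, φ e f = Real.log t + Real.log (u e) - Real.log (outdeg e)
      - ∑ f, stepProb G e f * Real.log (u f) := by
    intro e
    have hlogA : Real.log (A e) = Real.log t + Real.log (u e) - Real.log (outdeg e) := by
      rw [hA, Real.log_div (mul_pos ht0 (hpos e)).ne' (hd e).ne',
        Real.log_mul ht0.ne' (hpos e).ne']
    calc ∑ f, φ e f = ∑ f, (stepProb G e f * u f * (A e)⁻¹
          + stepProb G e f * (Real.log (A e) - 1) - stepProb G e f * Real.log (u f)) := by
          refine Finset.sum_congr rfl fun f _ => ?_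
          simp only [hφ]
          rw [Real.log_div (hpos f).ne' (hA0 e).ne']
          ring
      _ = _ := by
          rw [Finset.sum_sub_distrib, Finset.sum_add_distrib, ← Finset.sum_mul, ← Finset.sum_mul,
            hPu, hG.sum_stepProb, mul_inv_cancel₀ (hA0 e).ne', ← hlogA]
          ring
  have htot : ∑ e, ∑ f, φ e f = 0 := by
    simp_rw [hrow]
    rw [Finset.sum_sub_distrib, Finset.sum_sub_distrib, Finset.sum_add_distrib,
      hG.sum_sum_stepProb_mul fun f => Real.log (u f), ← hG.card_mul_log_Lam, ← ht]
    simp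
  have h1 := (Finset.sum_eq_zero_iff_of_nonneg fun a _ => Finset.sum_nonneg fun b _ => hnn a b).1
    htot e (Finset.mem_univ e)
  have h2 := (Finset.sum_eq_zero_iff_of_nonneg fun b _ => hnn e b).1 h1 f (Finset.mem_univ f)
  have h3 := (mul_eq_zero.1 h2).resolve_left (hG.stepProb_pos hef).ne'
  have h4 : u f / A e = 1 := by
    by_contra hne
    linarith [Real.log_lt_sub_one_of_pos (div_pos (hpos f) (hA0 e)) hne]
  rw [div_eq_one_iff_eq (hA0 e).ne'] at h4
  rw [h4, hA]
  exact mul_div_cancel₀ _ (hd e).ne'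

/-- If `log₂ ∘ outdeg` is cohomologous to the constant `log₂ Λ` along steps, then the exponential of
the transfer function is an eigenvector with eigenvalue `Λ`. -/
theorem NBIrreducible.rho_eq_Lam_of_coboundary (hG : NBIrreducible G) (v₀ : V) {h : G.Dart → ℝ}
    (hh : ∀ e f, Step e f → Real.logb 2 (outdeg e) = Real.logb 2 (Lam G) + h e - h f) :
    rho G v₀ = Lam G := by
  classical
  refine hG.rho_eq v₀ (u := fun e => (2 : ℝ) ^ h e) (fun e => by positivity) fun e => ?_
  have hd : (0 : ℝ) < outdeg e := Nat.cast_pos.2 (hG.outdeg_pos e)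
  have hf : ∀ f ∈ Finset.univ.filter (fun f => Step e f),
      (2 : ℝ) ^ h f = Lam G * 2 ^ h e / outdeg e := by
    intro f hf
    have h1 : h f = Real.logb 2 (Lam G) + h e - Real.logb 2 (outdeg e) := by
      linarith [hh e f (by simpa using hf)]
    rw [h1, Real.rpow_sub two_pos, Real.rpow_add two_pos,
      Real.rpow_logb two_pos (by norm_num) hG.Lam_pos, Real.rpow_logb two_pos (by norm_num) hd]
  rw [sum_hashimoto_mul, Finset.sum_congr rfl hf, Finset.sum_const, card_step_left, nsmul_eq_mul]
  exact mul_div_cancel₀ _ hd.ne'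

end

/-! ### Moments of additive functionals of the stationary walk -/

section

variable {V : Type*} {G : SimpleGraph V}

theorem sum_sub_telescope {α : Type*} {ℓ : ℕ} (h : α → ℝ) (ω : Fin (ℓ + 1) → α) :
    ∑ i : Fin ℓ, (h (ω i.castSucc) - h (ω i.succ)) = h (ω 0) - h (ω (Fin.last ℓ)) := by
  have h1 := Fin.sum_univ_succ fun i => h (ω i)
  rw [Fin.sum_univ_castSucc] at h1
  rw [Finset.sum_sub_distrib]
  linarith

theorem sum_snoc {α : Type*} {ℓ : ℕ} (d : α → α → ℝ) (ω : Fin (ℓ + 1) → α) (a : α) :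
    ∑ i : Fin (ℓ + 1), d (Fin.snoc (α := fun _ => α) ω a i.castSucc)
        (Fin.snoc (α := fun _ => α) ω a i.succ) =
      ∑ i : Fin ℓ, d (ω i.castSucc) (ω i.succ) + d (ω (Fin.last ℓ)) a := by
  rw [Fin.sum_univ_castSucc]
  simp only [Fin.succ_castSucc, Fin.snoc_castSucc, Fin.succ_last, Fin.snoc_last]

section
variable [Fintype V] [DecidableRel G.Adj]

instance (G : SimpleGraph V) [DecidableRel G.Adj] (ℓ : ℕ) : Finite (Walks G ℓ) :=
  inferInstanceAs (Finite {_ω : Fin (ℓ + 1) → G.Dart // _})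

/-- The expectation of `F (e₀, …, e_ℓ)` for the stationary non-backtracking random walk, as a sum
over all sequences of directed edges, those that are not walks having weight zero. -/
noncomputable def walkExp (G : SimpleGraph V) [DecidableRel G.Adj] (ℓ : ℕ)
    (F : (Fin (ℓ + 1) → G.Dart) → ℝ) : ℝ :=
  ∑ ω, (1 / (Fintype.card G.Dart : ℝ) * ∏ i : Fin ℓ, stepProb G (ω i.castSucc) (ω i.succ)) * F ω

theorem walkExp_add (ℓ : ℕ) (F F' : (Fin (ℓ + 1) → G.Dart) → ℝ) :
    walkExp G ℓ (fun ω => F ω + F' ω) = walkExp G ℓ F + walkExp G ℓ F' := by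
  simp only [walkExp, mul_add, Finset.sum_add_distrib]

/-- Conditioning on the first `ℓ` steps. -/
theorem walkExp_succ (ℓ : ℕ) (F : (Fin (ℓ + 2) → G.Dart) → ℝ) :
    walkExp G (ℓ + 1) F = walkExp G ℓ fun ω =>
      ∑ f, stepProb G (ω (Fin.last ℓ)) f * F (Fin.snoc (α := fun _ => G.Dart) ω f) := by
  unfold walkExp
  rw [← (Fin.snocEquiv fun _ : Fin (ℓ + 2) => G.Dart).sum_comp, Fintype.sum_prod_type_right]
  refine Finset.sum_congr rfl fun ω _ => ?_
  rw [Finset.mul_sum]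
  refine Finset.sum_congr rfl fun f _ => ?_
  simp only [Fin.snocEquiv, Equiv.coe_fn_mk, Fin.prod_univ_castSucc, Fin.succ_castSucc,
    Fin.snoc_castSucc, Fin.succ_last, Fin.snoc_last]
  ring

theorem NBIrreducible.walkExp_last (hG : NBIrreducible G) (ℓ : ℕ) (s : G.Dart → ℝ) :
    walkExp G ℓ (fun ω => s (ω (Fin.last ℓ))) = 1 / (Fintype.card G.Dart : ℝ) * ∑ e, s e := by
  induction ℓ generalizing s with
  | zero =>
    rw [walkExp, ← (Equiv.funUnique (Fin 1) G.Dart).symm.sum_comp, Finset.mul_sum]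
    simp
  | succ ℓ ih =>
    rw [walkExp_succ]
    simp only [Fin.snoc_last]
    rw [ih fun e => ∑ f, stepProb G e f * s f, hG.sum_sum_stepProb_mul]

theorem NBIrreducible.walkExp_martingale (hG : NBIrreducible G) {d : G.Dart → G.Dart → ℝ}
    (hd : ∀ e, ∑ f, stepProb G e f * d e f = 0) (ℓ : ℕ) :
    walkExp G ℓ (fun ω => ∑ i : Fin ℓ, d (ω i.castSucc) (ω i.succ)) = 0 := by
  induction ℓ with
  | zero => simp [walkExp]
  | succ ℓ ih =>
    rw [walkExp_succ]
    simp only [sum_snoc, mul_add, Finset.sum_add_distrib, hd, ← Finset.sum_mul, hG.sum_stepProb,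
      one_mul, add_zero]
    exact ih

/-- Martingale increments are orthogonal. -/
theorem NBIrreducible.walkExp_martingale_sq (hG : NBIrreducible G) {d : G.Dart → G.Dart → ℝ}
    (hd : ∀ e, ∑ f, stepProb G e f * d e f = 0) (ℓ : ℕ) :
    walkExp G ℓ (fun ω => (∑ i : Fin ℓ, d (ω i.castSucc) (ω i.succ)) ^ 2) =
      ℓ * (1 / (Fintype.card G.Dart : ℝ) * ∑ e, ∑ f, stepProb G e f * d e f ^ 2) := by
  induction ℓ with
  | zero => simp [walkExp]
  | succ ℓ ih =>
    have h1 : ∀ (m : ℝ) (e : G.Dart), ∑ f, stepProb G e f * (m + d e f) ^ 2 =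
        m ^ 2 + ∑ f, stepProb G e f * d e f ^ 2 := by
      intro m e
      calc ∑ f, stepProb G e f * (m + d e f) ^ 2 = ∑ f, (m ^ 2 * stepProb G e f
            + 2 * m * (stepProb G e f * d e f) + stepProb G e f * d e f ^ 2) :=
            Finset.sum_congr rfl fun f _ => by ring
        _ = _ := by
            rw [Finset.sum_add_distrib, Finset.sum_add_distrib, ← Finset.mul_sum,
              ← Finset.mul_sum, hd, hG.sum_stepProb]
            ring
    rw [walkExp_succ]
    simp only [sum_snoc, h1]
    rw [walkExp_add, ih, hG.walkExp_last ℓ fun e => ∑ f, stepProb G e f * d e f ^ 2]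
    push_cast
    ring

theorem walkProb_nonneg {ℓ : ℕ} (ω : Walks G ℓ) : 0 ≤ walkProb G ω := by
  unfold walkProb
  positivity

instance {ℓ : ℕ} (ω : Walks G ℓ) :
    IsFiniteMeasure (ENNReal.ofReal (walkProb G ω) • Measure.dirac ω) :=
  Measure.smul_finite _ ENNReal.ofReal_ne_top

instance (ℓ : ℕ) : IsFiniteMeasure (walkMeasure G ℓ) := by
  have := Fintype.ofFinite (Walks G ℓ)
  rw [walkMeasure, Measure.sum_fintype]
  infer_instance

theorem integral_walkMeasure (ℓ : ℕ) (F : (Fin (ℓ + 1) → G.Dart) → ℝ) :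
    ∫ ω, F ω.1 ∂walkMeasure G ℓ = walkExp G ℓ F := by
  classical
  have := Fintype.ofFinite (Walks G ℓ)
  have h1 : ∫ ω, F ω.1 ∂walkMeasure G ℓ = ∑ ω : Walks G ℓ, walkProb G ω * F ω.1 := by
    rw [walkMeasure, Measure.sum_fintype, integral_finsetSum_measure fun ω _ => .of_finite]
    refine Finset.sum_congr rfl fun ω _ => ?_
    rw [integral_smul_measure, integral_dirac, ENNReal.toReal_ofReal (walkProb_nonneg ω),
      smul_eq_mul]
  rw [h1, walkExp]
  refine Finset.sum_bij_ne_zero (fun ω _ _ => ω.1) (fun _ _ _ => Finset.mem_univ _)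
    (fun _ _ _ _ _ _ h => Subtype.ext h) (fun ω _ hω => ?_) fun ω _ _ => ?_
  · have h2 : ∀ i : Fin ℓ, Step (ω i.castSucc) (ω i.succ) := by
      intro i
      by_contra hi
      refine hω ?_
      rw [Finset.prod_eq_zero (Finset.mem_univ i) (if_neg hi), mul_zero, zero_mul]
    have h3 : walkProb G ⟨ω, h2⟩ = 1 / (Fintype.card G.Dart : ℝ) *
        ∏ i : Fin ℓ, stepProb G (ω i.castSucc) (ω i.succ) :=
      congrArg _ (Finset.prod_congr rfl fun i _ => (if_pos (h2 i)).symm)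
    exact ⟨⟨ω, h2⟩, Finset.mem_univ _, by rwa [h3], rfl⟩
  · rw [walkProb]
    congr 2
    exact Finset.prod_congr rfl fun i _ => (if_pos (ω.2 i)).symm

theorem NBIrreducible.isProbabilityMeasure (hG : NBIrreducible G) (ℓ : ℕ) :
    IsProbabilityMeasure (walkMeasure G ℓ) := by
  have := hG.nonempty_dart
  have h1 := (integral_walkMeasure (G := G) ℓ fun _ => 1).trans (hG.walkExp_last ℓ fun _ => 1)
  refine ⟨?_⟩
  simp only [integral_const, smul_eq_mul, mul_one, Finset.sum_const, Finset.card_univ,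
    nsmul_eq_mul] at h1
  rw [one_div, inv_mul_cancel₀ (by positivity)] at h1
  exact (ENNReal.toReal_eq_one_iff _).1 h1

end

/-- A bounded perturbation changes the variance of a centred variable by at most a constant, up to a
factor two. -/
theorem variance_perturb {Ω : Type*} [MeasurableSpace Ω] [MeasurableSingletonClass Ω] [Finite Ω]
    {μ : Measure Ω} [IsProbabilityMeasure μ] {X M Y : Ω → ℝ} {c K : ℝ}
    (hX : ∀ ω, X ω = c + M ω + Y ω) (hM : ∫ ω, M ω ∂μ = 0) (hY : ∀ ω, |Y ω| ≤ K) :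
    variance X μ ≤ 2 * ∫ ω, M ω ^ 2 ∂μ + 8 * K ^ 2 ∧
      ∫ ω, M ω ^ 2 ∂μ ≤ 2 * variance X μ + 8 * K ^ 2 := by
  have hint : ∀ F : Ω → ℝ, Integrable F μ := fun F => .of_finite
  set m := ∫ ω, Y ω ∂μ with hm
  have hmK : |m| ≤ K := by
    have := norm_integral_le_of_norm_le_const (μ := μ) (f := Y) (C := K) (.of_forall hY)
    simpa using this
  have hEX : ∫ ω, X ω ∂μ = c + m := by
    simp_rw [hX]
    rw [integral_add (hint _) (hint _), integral_add (hint _) (hint _), hM]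
    simp [hm]
  have hvar : variance X μ = ∫ ω, (M ω + (Y ω - m)) ^ 2 ∂μ := by
    rw [variance_eq_integral (measurable_of_finite X).aemeasurable, hEX]
    congr 1
    ext ω
    rw [hX]
    ring
  have hZ : ∀ ω, (Y ω - m) ^ 2 ≤ 4 * K ^ 2 := fun ω => by
    have h1 := abs_le.1 (hY ω)
    have h2 := abs_le.1 hmK
    nlinarith
  have key : ∀ F F' : Ω → ℝ, (∀ ω, F ω ≤ 2 * F' ω + 8 * K ^ 2) →
      ∫ ω, F ω ∂μ ≤ 2 * ∫ ω, F' ω ∂μ + 8 * K ^ 2 := by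
    intro F F' h
    refine (integral_mono (hint _) (hint _) h).trans_eq ?_
    rw [integral_add (hint _) (hint _), integral_const_mul]
    simp
  rw [hvar]
  refine ⟨key _ _ fun ω => ?_, key _ _ fun ω => ?_⟩
  · nlinarith [hZ ω, sq_nonneg (M ω - (Y ω - m))]
  · nlinarith [hZ ω, sq_nonneg (M ω + 2 * (Y ω - m))]

/-- The variance of `R_ℓ` from a decomposition of `log₂ ∘ outdeg` into a constant, martingale
increments `d` and a coboundary: it is `ℓ` times the mean square of `d`, up to a factor two and a
bounded error. -/
theorem NBIrreducible.exists_variance_bits_bounds [Fintype V] [DecidableRel G.Adj]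
    (hG : NBIrreducible G) {c : ℝ} {h : G.Dart → ℝ} {d : G.Dart → G.Dart → ℝ}
    (hd : ∀ e, ∑ f, stepProb G e f * d e f = 0)
    (hdec : ∀ e f, Step e f → Real.logb 2 (outdeg e) = c + d e f + (h e - h f)) :
    ∃ K : ℝ, ∀ ℓ : ℕ,
      variance (bits G ℓ) (walkMeasure G ℓ) ≤
        2 * (ℓ * (1 / (Fintype.card G.Dart : ℝ) * ∑ e, ∑ f, stepProb G e f * d e f ^ 2)) + K ∧
      ℓ * (1 / (Fintype.card G.Dart : ℝ) * ∑ e, ∑ f, stepProb G e f * d e f ^ 2) ≤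
        2 * variance (bits G ℓ) (walkMeasure G ℓ) + K := by
  refine ⟨8 * (∑ e, |h e| + ∑ e, |h e|) ^ 2, fun ℓ => ?_⟩
  have := hG.isProbabilityMeasure ℓ
  have hle : ∀ e, |h e| ≤ ∑ e, |h e| := fun e =>
    Finset.single_le_sum (f := fun e => |h e|) (fun _ _ => abs_nonneg _) (Finset.mem_univ e)
  have hbits : ∀ ω : Walks G ℓ, bits G ℓ ω = ℓ * c
      + ∑ i : Fin ℓ, d (ω.1 i.castSucc) (ω.1 i.succ) + (h (ω.1 0) - h (ω.1 (Fin.last ℓ))) := by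
    intro ω
    rw [bits, ← sum_sub_telescope, Finset.sum_congr rfl fun i _ => hdec _ _ (ω.2 i),
      Finset.sum_add_distrib, Finset.sum_add_distrib]
    simp
  have hE := (integral_walkMeasure ℓ _).trans (hG.walkExp_martingale hd ℓ)
  have hE2 := (integral_walkMeasure ℓ _).trans (hG.walkExp_martingale_sq hd ℓ)
  have key := variance_perturb hbits hE fun ω =>
    (abs_sub _ _).trans (add_le_add (hle (ω.1 0)) (hle (ω.1 (Fin.last ℓ))))
  rwa [hE2] at key

theorem NBIrreducible.variance_bits_isBigO_one [Fintype V] [DecidableRel G.Adj]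
    (hG : NBIrreducible G) (v₀ : V) (hρ : rho G v₀ = Lam G) :
    (fun ℓ : ℕ => variance (bits G ℓ) (walkMeasure G ℓ)) =O[atTop] fun _ : ℕ => (1 : ℝ) := by
  obtain ⟨t, u, hpos, hu⟩ := hG.exists_pos_eigenvector
  have ht : t = Lam G := (hG.rho_eq v₀ hpos hu).symm.trans hρ
  obtain ⟨K, hK⟩ := hG.exists_variance_bits_bounds (c := Real.logb 2 t)
    (h := fun e => Real.logb 2 (u e)) (d := fun _ _ => 0) (by simp) fun e f hef => by
      have hd : (0 : ℝ) < outdeg e := Nat.cast_pos.2 (hG.outdeg_pos e)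
      have ht0 : 0 < t := ht ▸ hG.Lam_pos
      have h1 := congrArg (Real.logb 2) (hG.outdeg_mul_eq hpos hu ht hef)
      rw [Real.logb_mul hd.ne' (hpos f).ne', Real.logb_mul ht0.ne' (hpos e).ne'] at h1
      linarith
  refine IsBigO.of_bound K (.of_forall fun ℓ => ?_)
  rw [Real.norm_of_nonneg (variance_nonneg _ _)]
  simpa using (hK ℓ).1

theorem NBIrreducible.variance_bits_isTheta [Fintype V] [DecidableRel G.Adj]
    (hG : NBIrreducible G) (v₀ : V) (hρ : rho G v₀ ≠ Lam G) :
    (fun ℓ : ℕ => variance (bits G ℓ) (walkMeasure G ℓ)) =Θ[atTop] fun ℓ : ℕ => (ℓ : ℝ) := by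
  have := hG.nonempty_dart
  have hmean : ∑ e : G.Dart, (Real.logb 2 (outdeg e) - Real.logb 2 (Lam G)) = 0 := by
    simp only [Real.logb, ← sub_div]
    rw [← Finset.sum_div, Finset.sum_sub_distrib, ← hG.card_mul_log_Lam]
    simp
  obtain ⟨h, hh⟩ := hG.exists_poisson hmean
  set d : G.Dart → G.Dart → ℝ := fun e f => h f - ∑ f', stepProb G e f' * h f' with hd
  have hd0 : ∀ e, ∑ f, stepProb G e f * d e f = 0 := fun e => by
    simp only [hd, mul_sub, Finset.sum_sub_distrib]
    rw [← Finset.sum_mul, hG.sum_stepProb, one_mul, sub_self]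
  obtain ⟨K, hK⟩ := hG.exists_variance_bits_bounds (c := Real.logb 2 (Lam G)) (h := h) hd0
    fun e f _ => by simp only [hd]; linarith [hh e]
  set σ2 : ℝ := 1 / (Fintype.card G.Dart : ℝ) * ∑ e, ∑ f, stepProb G e f * d e f ^ 2
  have hnn : ∀ e f, 0 ≤ stepProb G e f * d e f ^ 2 := fun e f =>
    mul_nonneg (stepProb_nonneg e f) (sq_nonneg _)
  -- If `d` vanished along steps, then `log₂ ∘ outdeg` would be cohomologous to a constant.
  have hσ : 0 < σ2 := by
    refine mul_pos (by positivity) ((Finset.sum_nonneg fun e _ =>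
      Finset.sum_nonneg fun f _ => hnn e f).lt_of_ne' fun h0 => hρ ?_)
    refine hG.rho_eq_Lam_of_coboundary v₀ (h := h) fun e f hef => ?_
    have h1 := (Finset.sum_eq_zero_iff_of_nonneg fun a _ => Finset.sum_nonneg fun b _ => hnn a b).1
      h0 e (Finset.mem_univ e)
    have h2 := (Finset.sum_eq_zero_iff_of_nonneg fun b _ => hnn e b).1 h1 f (Finset.mem_univ f)
    have h3 : d e f = 0 := pow_eq_zero_iff two_ne_zero |>.1
      ((mul_eq_zero.1 h2).resolve_left (hG.stepProb_pos hef).ne')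
    simp only [hd] at h3
    linarith [hh e]
  have hlarge : ∀ᶠ ℓ : ℕ in atTop, 2 * K ≤ ℓ * σ2 :=
    (tendsto_natCast_atTop_atTop.atTop_mul_const hσ).eventually_ge_atTop _
  constructor
  · refine IsBigO.of_bound (3 * σ2) ?_
    filter_upwards [hlarge] with ℓ hℓ
    rw [Real.norm_of_nonneg (variance_nonneg _ _), Real.norm_of_nonneg ℓ.cast_nonneg]
    have h0 : 0 ≤ ℓ * σ2 := by positivity
    linarith [(hK ℓ).1]
  · refine IsBigO.of_bound (4 / σ2) ?_
    filter_upwards [hlarge] with ℓ hℓ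
    rw [Real.norm_of_nonneg (variance_nonneg _ _), Real.norm_of_nonneg ℓ.cast_nonneg,
      div_mul_eq_mul_div, le_div_iff₀ hσ]
    linarith [(hK ℓ).2]

end

end NBRW

theorem theorem2 {V : Type*} [Fintype V] (G : SimpleGraph V) [DecidableRel G.Adj]
    (hG : NBRW.NBIrreducible G) (v₀ : V) :
    (NBRW.rho G v₀ = NBRW.Lam G →
      (fun ℓ : ℕ => variance (NBRW.bits G ℓ) (NBRW.walkMeasure G ℓ)) =O[atTop]
        fun _ : ℕ => (1 : ℝ)) ∧
    (NBRW.Lam G < NBRW.rho G v₀ →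
      (fun ℓ : ℕ => variance (NBRW.bits G ℓ) (NBRW.walkMeasure G ℓ)) =Θ[atTop]
        fun ℓ : ℕ => (ℓ : ℝ)) := by
  exact ⟨fun h => hG.variance_bits_isBigO_one v₀ h, fun h => hG.variance_bits_isTheta v₀ h.ne'⟩
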